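/- Let $(\Gamma,+)$ be an Abelian group of order $n^2>1$, where $n$ is a positive integer. A \emph{zero-sum $\Gamma$-magic square} of side $n$ is an $n\times n$ array whose entries are the elements of $\Gamma$, each appearing exactly once, such that the sum of the entries in every row, in every column, on the main diagonal and on the antidiagonal is $0$; it is \emph{non-trivial} if $n\neq 1$. An \emph{involution} of $\Gamma$ is an element $\iota\in\Gamma$ with $\iota\ne 0$ and $2\iota=0$, and $\mathcal{G}$ denotes the class of all Abelian groups that have odd order or contain more than one involution. Then there exists a non-trivial zero-sum $\Gamma$-magic square of side $n$ if and only if $n>2$ and $\Gamma\in\mathcal{G}$. -/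

import Mathlib

/-- An involution of an Abelian group: an element of order two. -/
def IsInvolution {Γ : Type*} [AddCommGroup Γ] (g : Γ) : Prop :=
  g ≠ 0 ∧ 2 • g = 0

/-- The class `𝒢` of Abelian groups that have odd order or contain more than one involution.
(An infinite group has `Nat.card Γ = 0`, so it does not count as a group of odd order.) -/
def InClassG (Γ : Type*) [AddCommGroup Γ] : Prop :=
  Odd (Nat.card Γ) ∨ ∃ g h : Γ, g ≠ h ∧ IsInvolution g ∧ IsInvolution h

/-- `A` is a `Γ`-magic square of side `n` with magic constant `μ`: every element of `Γ` appears
exactly once as an entry of `A`, and all row sums, all column sums, the main diagonal sum and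
the antidiagonal sum are equal to `μ`. -/
structure IsMagicSquare {Γ : Type*} [AddCommGroup Γ] {n : ℕ}
    (A : Fin n → Fin n → Γ) (μ : Γ) : Prop where
  entries : ∀ g : Γ, ∃! p : Fin n × Fin n, A p.1 p.2 = g
  row_sum : ∀ i, ∑ j, A i j = μ
  col_sum : ∀ j, ∑ i, A i j = μ
  diag_sum : ∑ i, A i i = μ
  antidiag_sum : ∑ i, A i (Fin.rev i) = μ

/-- A zero-sum `Γ`-magic square of side `n`. -/
def IsZeroSumMagicSquare {Γ : Type*} [AddCommGroup Γ] {n : ℕ} (A : Fin n → Fin n → Γ) : Prop :=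
  IsMagicSquare A 0

/-- There is a non-trivial zero-sum `Γ`-magic square of side `n`; a magic square is trivial when
its side is `1`. -/
def ExistsNontrivialZMS (Γ : Type*) [AddCommGroup Γ] (n : ℕ) : Prop :=
  n ≠ 1 ∧ ∃ A : Fin n → Fin n → Γ, IsZeroSumMagicSquare A

/-! Necessity: adding the rows shows that all elements of `Γ` sum to 0, while a group with exactly
one involution sums to that involution. For side 2, equal first row and column sums force a repeated
entry.

Sufficiency: for odd n, take a subgroup H of order n, index `Γ ⧸ H` and H by `ZMod n`, and put in
cell (i, j) the coset of index i + j shifted by the element of H of index i - j. For n = 2m, two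
involutions span a Klein group V, and a square for `Γ ⧸ V` inflates: each cell becomes a 2 × 2 block
filled with a coset of V. This settles odd m. For n = 4k, if some e is not a double and 2k • e = 0,
half of the cells of an addition table are exchanged with their central reflections. Otherwise every
involution is a double, and halves of two generators of V become distinct involutions of `Γ ⧸ V`, so
induction gives a square to inflate. Only k = 1 escapes, since side 2 is impossible; there `ZMod 4 ×
ZMod 4` has an explicit square. -/

open Finset

/-- The entry condition of a magic square is bijectivity. -/
theorem existsUnique_entry_iff_bijective {Γ : Type*} {n : ℕ} (A : Fin n → Fin n → Γ) :
    (∀ g : Γ, ∃! p : Fin n × Fin n, A p.1 p.2 = g) ↔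
      Function.Bijective (fun p : Fin n × Fin n => A p.1 p.2) :=
  (Function.bijective_iff_existsUnique _).symm

/-- If `Γ` has `n ^ 2` elements, distinctness of the entries suffices. -/
theorem existsUnique_entry_of_injective {Γ : Type*} {n : ℕ} (A : Fin n → Fin n → Γ)
    (hn : n ≠ 0) (hcard : Nat.card Γ = n ^ 2)
    (h : Function.Injective (fun p : Fin n × Fin n => A p.1 p.2)) (g : Γ) :
    ∃! p : Fin n × Fin n, A p.1 p.2 = g := by
  have : Finite Γ := Nat.finite_of_card_ne_zero (by rw [hcard]; positivity)
  exact (existsUnique_entry_iff_bijective A).2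
    (h.bijective_of_nat_card_le (by simp [hcard, sq])) g

/-- Cauchy gives a subgroup of prime order `d.minFac`; a subgroup of order d / `d.minFac` in the
quotient, found by induction, pulls back to one of order d. -/
theorem AddSubgroup.exists_card_eq_of_dvd (d : ℕ) :
    ∀ {G : Type*} [AddCommGroup G] [Finite G], d ∣ Nat.card G →
      ∃ H : AddSubgroup G, Nat.card H = d := by
  induction d using Nat.strong_induction_on with
  | _ d ih =>
    intro G _ _ hd
    have hd0 : d ≠ 0 := by
      rintro rfl
      exact Nat.card_pos.ne' (zero_dvd_iff.1 hd)
    rcases eq_or_ne d 1 with rfl | hd1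
    · exact ⟨⊥, by simp⟩
    have hp : d.minFac.Prime := Nat.minFac_prime hd1
    have : Fact d.minFac.Prime := ⟨hp⟩
    obtain ⟨k, hk⟩ := d.minFac_dvd
    obtain ⟨g, hg⟩ := exists_prime_addOrderOf_dvd_card' (G := G) d.minFac
      (d.minFac_dvd.trans hd)
    have hN : Nat.card (AddSubgroup.zmultiples g) = d.minFac := by
      rw [Nat.card_zmultiples, hg]
    have hq := AddSubgroup.card_eq_card_quotient_mul_card_addSubgroup (AddSubgroup.zmultiples g)
    rw [hN] at hq
    have hk0 : 0 < k := Nat.pos_of_ne_zero (by rintro rfl; simp at hk; exact hd0 hk)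
    have hkd : k < d := by
      have := hp.two_le
      nlinarith
    have hkq : k ∣ Nat.card (G ⧸ AddSubgroup.zmultiples g) := by
      refine Nat.dvd_of_mul_dvd_mul_left hp.pos ?_
      rw [← hk, mul_comm d.minFac, ← hq]
      exact hd
    obtain ⟨K, hK⟩ := ih k hkd hkq
    refine ⟨K.comap (QuotientAddGroup.mk' _), ?_⟩
    have h1 := K.card_mul_index
    have h2 := (K.comap (QuotientAddGroup.mk' (AddSubgroup.zmultiples g))).card_mul_index
    rw [AddSubgroup.index_comap_of_surjective _ (QuotientAddGroup.mk'_surjective _), hq, ← h1,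
      hK] at h2
    have hi : 0 < K.index := Nat.pos_of_ne_zero AddSubgroup.index_ne_zero_of_finite
    refine Nat.eq_of_mul_eq_mul_right hi (h2.trans ?_)
    rw [mul_right_comm, mul_comm k, ← hk]

/-! ### Necessity -/

/-- An abelian group with exactly one involution has nonzero sum of elements. -/
theorem sum_eq_of_unique_involution {Γ : Type*} [AddCommGroup Γ] [Fintype Γ] {ι : Γ}
    (hι : IsInvolution ι) (huniq : ∀ g : Γ, IsInvolution g → g = ι) : ∑ g : Γ, g = ι := by
  classical
  rw [← Finset.add_sum_erase _ _ (mem_univ ι)]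
  suffices h : ∑ g ∈ univ.erase ι, g = 0 by simp [h]
  refine Finset.sum_involution (fun g _ => -g) (fun g _ => by simp) ?_ ?_ (fun g _ => by simp)
  · intro g hg hg0 hneg
    refine (Finset.mem_erase.1 hg).1 (huniq g ⟨hg0, ?_⟩)
    rw [two_nsmul]
    nth_rewrite 1 [← hneg]
    simp
  · intro g hg
    have h2 : -ι = ι := by
      have := hι.2
      rw [two_nsmul] at this
      exact neg_eq_of_add_eq_zero_left this
    simp only [mem_erase, mem_univ, and_true] at hg ⊢
    intro h
    apply hg
    rw [← h2, ← h, neg_neg]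

/-- The sum equals its own negative, so it is killed by 2 and by an odd number. -/
theorem sum_eq_zero_of_odd_card {Γ : Type*} [AddCommGroup Γ] (hodd : Odd (Nat.card Γ))
    {ι : Type*} [Fintype ι] (σ : ι ≃ ι) (f : ι → Γ) (hf : ∀ i, f (σ i) = - f i) :
    ∑ i, f i = 0 := by
  have h : ∑ i, f i = - ∑ i, f i := by
    rw [← Finset.sum_neg_distrib, ← Equiv.sum_comp σ]
    simp [hf]
  have h2 : 2 • ∑ i, f i = 0 := by
    rw [two_nsmul]
    nth_rewrite 1 [h]
    simp
  have hc : Nat.card Γ • ∑ i, f i = 0 := by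
    have : Finite Γ := Nat.finite_of_card_ne_zero (by rintro h; simp [h] at hodd)
    exact card_nsmul_eq_zero'
  obtain ⟨k, hk⟩ := hodd
  rw [hk, add_nsmul, mul_nsmul, h2] at hc
  simpa using hc

/-- Necessity of membership in the class `𝒢`. -/
theorem IsZeroSumMagicSquare.inClassG {Γ : Type*} [AddCommGroup Γ] [Finite Γ] {n : ℕ}
    {A : Fin n → Fin n → Γ} (hA : IsZeroSumMagicSquare A) : InClassG Γ := by
  by_contra hG
  rw [InClassG, not_or] at hG
  obtain ⟨hodd, hinv⟩ := hG
  rw [Nat.not_odd_iff_even, even_iff_two_dvd] at hodd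
  have := Fintype.ofFinite Γ
  obtain ⟨ι, hι⟩ := exists_prime_addOrderOf_dvd_card' (G := Γ) 2 hodd
  have hι' : IsInvolution ι :=
    ⟨by rintro rfl; simp at hι, by rw [← hι]; exact addOrderOf_nsmul_eq_zero ι⟩
  have hs := sum_eq_of_unique_involution hι' (fun g hg => by
    by_contra h
    exact hinv ⟨g, ι, h, hg, hι'⟩)
  have hbij := (existsUnique_entry_iff_bijective A).1 hA.entries
  rw [← hbij.sum_comp (fun g => g), Fintype.sum_prod_type] at hs
  simp only [hA.row_sum, sum_const_zero] at hs
  exact hι'.1 hs.symm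

theorem IsZeroSumMagicSquare.side_ne_two {Γ : Type*} [AddCommGroup Γ]
    {A : Fin 2 → Fin 2 → Γ} (hA : IsZeroSumMagicSquare A) : False := by
  have h1 := hA.row_sum 0
  have h2 := hA.col_sum 0
  rw [Fin.sum_univ_two] at h1 h2
  have h : A 0 1 = A 1 0 := add_left_cancel (h1.trans h2.symm)
  have := (hA.entries (A 0 1)).unique (y₁ := (0, 1)) (y₂ := (1, 0)) rfl h.symm
  simp at this

/-! ### Odd side -/

theorem exists_odd_transversal {G : Type*} [AddCommGroup G] (hodd : Odd (Nat.card G))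
    (H : AddSubgroup G) : ∃ r : G ⧸ H → G, (∀ q, (r q : G ⧸ H) = q) ∧ ∀ q, r (-q) = - r q := by
  obtain ⟨k, hk⟩ := hodd
  have : Finite G := Nat.finite_of_card_ne_zero (by omega)
  -- Multiplication by k + 1 is halving in a group of order 2k + 1, so this is the odd part of
  -- `Quotient.out`.
  refine ⟨fun q => (k + 1) • (q.out - (-q).out), fun q => ?_, fun q => ?_⟩
  · have h0 : Nat.card G • q = 0 := by
      rw [← QuotientAddGroup.out_eq' q, ← QuotientAddGroup.mk_nsmul, card_nsmul_eq_zero',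
        QuotientAddGroup.mk_zero]
    rw [QuotientAddGroup.mk_nsmul, QuotientAddGroup.mk_sub, QuotientAddGroup.out_eq',
      QuotientAddGroup.out_eq', sub_neg_eq_add, ← two_nsmul, ← mul_nsmul,
      show 2 * (k + 1) = Nat.card G + 1 by omega, add_nsmul, h0, one_nsmul, zero_add]
  · simp only [neg_neg, ← smul_neg, neg_sub]

theorem exists_zeroSumMagicSquare_of_odd {Γ : Type*} [AddCommGroup Γ] {n : ℕ} (hn : Odd n)
    (hcard : Nat.card Γ = n ^ 2) : ∃ A : Fin n → Fin n → Γ, IsZeroSumMagicSquare A := by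
  have hodd : Odd (Nat.card Γ) := hcard ▸ hn.pow
  have hn0 : n ≠ 0 := by rintro rfl; simp at hn
  have : NeZero n := ⟨hn0⟩
  have : Finite Γ := Nat.finite_of_card_ne_zero (by rw [hcard]; positivity)
  obtain ⟨H, hH⟩ := AddSubgroup.exists_card_eq_of_dvd n (G := Γ) (by rw [hcard, sq]; simp)
  have hQ : Nat.card (Γ ⧸ H) = n := by
    have := AddSubgroup.card_eq_card_quotient_mul_card_addSubgroup H
    rw [hH, hcard, sq] at this
    exact (Nat.eq_of_mul_eq_mul_right (Nat.pos_of_ne_zero hn0) this).symm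
  obtain ⟨r, hr, hrneg⟩ := exists_odd_transversal hodd H
  have := Fintype.ofFinite H
  have := Fintype.ofFinite (Γ ⧸ H)
  classical
  have hZ : Nat.card (ZMod n) = n := by simp
  -- On every row and column, i + j and i - j both run through `ZMod n`. On the main diagonal i - j
  -- is constantly 0, on the antidiagonal i + j is constantly -1; these indices are therefore sent
  -- to 0.
  let f : ZMod n ≃ Γ ⧸ H := ((Finite.equivFinOfCardEq hZ).trans (Finite.equivFinOfCardEq hQ).symm).setValue (-1) 0
  let g : ZMod n ≃ H := ((Finite.equivFinOfCardEq hZ).trans (Finite.equivFinOfCardEq hH).symm).setValue 0 0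
  have hf : f (-1) = 0 := Equiv.setValue_eq _ _ _
  have hg : g 0 = 0 := Equiv.setValue_eq _ _ _
  have hr0 : r 0 = 0 := by
    have h := sum_eq_zero_of_odd_card hodd (Equiv.refl Unit) (fun _ => r 0) (fun _ => by
      simpa using hrneg 0)
    simpa using h
  have hdbl : ∀ z w : ZMod n, z + z = w + w → z = w := by
    obtain ⟨k, hk⟩ := hn
    have h1 : ((k : ZMod n) + 1) * 2 = 1 := by
      have : ((2 * k + 1 : ℕ) : ZMod n) = 0 := by rw [← hk]; simp
      push_cast at this
      linear_combination this
    intro z w h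
    linear_combination (z - w) * (-h1) + ((k : ZMod n) + 1) * h
  let ρ : Fin n → ZMod n := fun i => (i.val : ZMod n)
  have hρ : Function.Injective ρ := by
    intro i j h
    have := congrArg ZMod.val h
    simp only [ρ, ZMod.val_cast_of_lt i.2, ZMod.val_cast_of_lt j.2] at this
    exact Fin.ext this
  have hρrev : ∀ i, ρ (Fin.rev i) = -1 - ρ i := by
    intro i
    have h : i.val + 1 + (Fin.rev i).val = n := by rw [Fin.val_rev]; omega
    have h' : ((i.val + 1 + (Fin.rev i).val : ℕ) : ZMod n) = 0 := by rw [h]; simp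
    push_cast at h'
    simp only [ρ]
    linear_combination h'
  have hbij : ∀ ψ : Fin n → ZMod n, Function.Injective ψ → Function.Bijective ψ := fun ψ hψ =>
    hψ.bijective_of_nat_card_le (by simp)
  have hfsum : ∀ ψ : Fin n → ZMod n, Function.Injective ψ → ∑ j, r (f (ψ j)) = 0 := by
    intro ψ hψ
    refine ((f.bijective.comp (hbij ψ hψ)).sum_comp r).trans ?_
    exact sum_eq_zero_of_odd_card hodd (Equiv.neg _) r hrneg
  have hgsum : ∀ ψ : Fin n → ZMod n, Function.Injective ψ → ∑ j, (g (ψ j) : Γ) = 0 := by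
    intro ψ hψ
    refine ((g.bijective.comp (hbij ψ hψ)).sum_comp (fun h : H => (h : Γ))).trans ?_
    exact sum_eq_zero_of_odd_card hodd (Equiv.neg _) _ (fun h => by simp)
  refine ⟨fun i j => r (f (ρ i + ρ j)) + g (ρ i - ρ j),
    existsUnique_entry_of_injective (fun i j => r (f (ρ i + ρ j)) + (g (ρ i - ρ j) : Γ)) hn0 hcard ?_, ?_, ?_, ?_, ?_⟩
  · rintro ⟨i, j⟩ ⟨i', j'⟩ h
    simp only at h
    have h1 : f (ρ i + ρ j) = f (ρ i' + ρ j') := by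
      have := congrArg (QuotientAddGroup.mk (s := H)) h
      simpa [hr, (QuotientAddGroup.eq_zero_iff _).2 (SetLike.coe_mem _)] using this
    rw [h1, add_right_inj, SetLike.coe_eq_coe, g.apply_eq_iff_eq] at h
    rw [f.apply_eq_iff_eq] at h1
    have hi : ρ i = ρ i' := hdbl _ _ (by linear_combination h + h1)
    have hj : ρ j = ρ j' := by linear_combination h1 - hi
    rw [hρ hi, hρ hj]
  · intro i
    rw [sum_add_distrib, hfsum _ fun a b h => hρ (add_left_cancel h),
      hgsum _ fun a b h => hρ (sub_right_injective h), add_zero]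
  · intro j
    rw [sum_add_distrib, hfsum _ fun a b h => hρ (add_right_cancel h),
      hgsum _ fun a b h => hρ (sub_left_injective h), add_zero]
  · rw [sum_add_distrib, hfsum _ fun a b h => hρ (hdbl _ _ h)]
    simp [hg]
  · simp only [hρrev]
    rw [sum_add_distrib, hgsum _ fun a b h => hρ (hdbl _ _ (by linear_combination h))]
    simp [hf, hr0]

/-! ### Inflation by a Klein four-group -/

theorem smul_add_smul_fin_two_injective {G : Type*} [AddCommGroup G] {s c : G}
    (hc2 : 2 • c = 0) (hs : s ≠ 0) (hc : c ≠ 0) (hsc : s ≠ c)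
    {u v u' v' : Fin 2} (h : u.val • c + v.val • s = u'.val • c + v'.val • s) :
    u = u' ∧ v = v' := by
  have hcs : c + s ≠ 0 := by
    intro h
    rw [two_nsmul] at hc2
    exact hsc (add_left_cancel (h.trans hc2.symm))
  revert h
  fin_cases u <;> fin_cases u' <;> fin_cases v <;> fin_cases v' <;>
    simp [hs, hs.symm, hc, hc.symm, hsc, hsc.symm, hcs, hcs.symm]

/-- Inflation: a zero-sum magic square of side `m` for `Γ ⧸ V`, with `V` of exponent two and order
four, gives one of side `m * 2` for `Γ`, provided that the row and column sums within the
`2 × 2` blocks can be balanced. -/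
theorem exists_zeroSumMagicSquare_of_quotient {Γ : Type*} [AddCommGroup Γ] {m : ℕ}
    (hm : m ≠ 0) (hcard : Nat.card Γ = (m * 2) ^ 2) (V : AddSubgroup Γ)
    (hV2 : ∀ v ∈ V, 2 • v = 0) {B : Fin m → Fin m → Γ ⧸ V} (hB : IsZeroSumMagicSquare B)
    (s c : Fin m → Fin m → Γ) (hsV : ∀ i j, s i j ∈ V) (hcV : ∀ i j, c i j ∈ V)
    (hs0 : ∀ i j, s i j ≠ 0) (hc0 : ∀ i j, c i j ≠ 0) (hsc : ∀ i j, s i j ≠ c i j)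
    (hs : ∀ i, ∑ j, s i j = 0) (hc : ∀ j, ∑ i, c i j = 0)
    (hd : ∑ i, (s i i + c i i) = 0) (ha : ∑ i, (s i (Fin.rev i) + c i (Fin.rev i)) = 0) :
    ∃ A : Fin (m * 2) → Fin (m * 2) → Γ, IsZeroSumMagicSquare A := by
  let φ : Fin m × Fin 2 ≃ Fin (m * 2) := finProdFinEquiv
  have hrev : ∀ i u, Fin.rev (φ (i, u)) = φ (Fin.rev i, Fin.rev u) := by
    intro i u
    ext
    simp only [φ, finProdFinEquiv_apply_val, Fin.val_rev]
    omega
  -- Up to twice the representative, a block has row sums s, column sums c and both diagonal sums s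
  -- + c.
  let E : Fin m × Fin 2 → Fin m × Fin 2 → Γ := fun p q =>
    (B p.1 q.1).out + (p.2.val • c p.1 q.1 + q.2.val • s p.1 q.1)
  let A : Fin (m * 2) → Fin (m * 2) → Γ := fun i j => E (φ.symm i) (φ.symm j)
  have hmem : ∀ p q : Fin m × Fin 2, p.2.val • c p.1 q.1 + q.2.val • s p.1 q.1 ∈ V := fun p q =>
    V.add_mem (V.nsmul_mem (hcV _ _) _) (V.nsmul_mem (hsV _ _) _)
  -- The representatives along a zero-sum line add up to an element of V, which doubling kills.
  have hout : ∀ F : Fin m → Γ ⧸ V, ∑ j, F j = 0 → ∑ j, 2 • (F j).out = 0 := by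
    intro F hF
    rw [← smul_sum]
    refine hV2 _ ((QuotientAddGroup.eq_zero_iff _).1 ?_)
    rw [← QuotientAddGroup.mk'_apply, map_sum]
    simpa using hF
  have hc2 : ∀ i j, 2 • c i j = 0 := fun i j => hV2 _ (hcV i j)
  have hs2 : ∀ i j, 2 • s i j = 0 := fun i j => hV2 _ (hsV i j)
  refine ⟨A, existsUnique_entry_of_injective _ (by omega) hcard ?_, ?_, ?_, ?_, ?_⟩
  · suffices h : ∀ p q p' q', E p q = E p' q' → p = p' ∧ q = q' by
      rintro ⟨i, j⟩ ⟨i', j'⟩ hij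
      obtain ⟨h1, h2⟩ := h _ _ _ _ hij
      exact Prod.ext (φ.symm.injective h1) (φ.symm.injective h2)
    rintro ⟨i, u⟩ ⟨j, v⟩ ⟨i', u'⟩ ⟨j', v'⟩ h
    have h1 : B i j = B i' j' := by
      have := (QuotientAddGroup.mk_add_of_mem _ (hmem (i, u) (j, v))).symm.trans
        ((congrArg (QuotientAddGroup.mk (s := V)) h).trans
          (QuotientAddGroup.mk_add_of_mem _ (hmem (i', u') (j', v'))))
      simpa using this
    have h2 := (hB.entries (B i' j')).unique (y₁ := (i, j)) (y₂ := (i', j')) h1 rfl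
    simp only [Prod.mk.injEq] at h2
    obtain ⟨rfl, rfl⟩ := h2
    simp only [E, add_right_inj] at h
    obtain ⟨rfl, rfl⟩ := smul_add_smul_fin_two_injective (hc2 i j) (hs0 i j) (hc0 i j)
      (hsc i j) h
    exact ⟨rfl, rfl⟩
  · intro i
    obtain ⟨⟨i, u⟩, rfl⟩ := φ.surjective i
    rw [← φ.sum_comp, Fintype.sum_prod_type]
    simp only [A, E, Equiv.symm_apply_apply, Fin.sum_univ_two]
    rw [← add_zero (0 : Γ)]
    nth_rewrite 1 [← hout _ (hB.row_sum i)]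
    rw [← hs i, ← sum_add_distrib]
    refine sum_congr rfl fun j _ => ?_
    have hu : u.val • c i j + u.val • c i j = 0 := by
      rw [← two_nsmul, smul_comm, hc2, smul_zero]
    rw [← add_zero (_ + s i j), ← hu]
    simp only [Fin.val_zero, Fin.val_one, zero_smul, one_smul, two_nsmul]
    abel
  · intro j
    obtain ⟨⟨j, u⟩, rfl⟩ := φ.surjective j
    rw [← φ.sum_comp, Fintype.sum_prod_type]
    simp only [A, E, Equiv.symm_apply_apply, Fin.sum_univ_two]
    rw [← add_zero (0 : Γ)]
    nth_rewrite 1 [← hout _ (hB.col_sum j)]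
    rw [← hc j, ← sum_add_distrib]
    refine sum_congr rfl fun i _ => ?_
    have hu : u.val • s i j + u.val • s i j = 0 := by
      rw [← two_nsmul, smul_comm, hs2, smul_zero]
    rw [← add_zero (_ + c i j), ← hu]
    simp only [Fin.val_zero, Fin.val_one, zero_smul, one_smul, two_nsmul]
    abel
  · rw [← φ.sum_comp, Fintype.sum_prod_type]
    simp only [A, E, Equiv.symm_apply_apply, Fin.sum_univ_two]
    rw [← add_zero (0 : Γ)]
    nth_rewrite 1 [← hout _ hB.diag_sum]
    rw [← hd, ← sum_add_distrib]
    refine sum_congr rfl fun i _ => ?_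
    simp only [Fin.val_zero, Fin.val_one, zero_smul, one_smul, two_nsmul]
    abel
  · rw [← φ.sum_comp, Fintype.sum_prod_type]
    simp only [hrev, A, E, Equiv.symm_apply_apply, Fin.sum_univ_two]
    rw [← add_zero (0 : Γ)]
    nth_rewrite 1 [← hout _ hB.antidiag_sum]
    rw [← ha, ← sum_add_distrib]
    refine sum_congr rfl fun i _ => ?_
    simp only [Fin.rev_zero, Fin.val_last, show Fin.rev (1 : Fin 2) = 0 from rfl,
      Fin.val_zero, Fin.val_one, zero_smul, one_smul, two_nsmul]
    abel

/-- The Klein four-group generated by two involutions. -/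
def kleinFour {G : Type*} [AddCommGroup G] {a b : G} (ha : 2 • a = 0) (hb : 2 • b = 0) :
    AddSubgroup G where
  carrier := {0, a, b, a + b}
  zero_mem' := by simp
  add_mem' := by
    rw [two_nsmul] at ha hb
    have hab : a + (a + b) = b := by rw [← add_assoc, ha, zero_add]
    have hba : b + (a + b) = a := by rw [add_left_comm, hb, add_zero]
    have hcomm := add_comm b a
    have h : a + b + a = b := by rw [add_comm, hab]
    have h' : a + b + b = a := by rw [add_assoc, hb, add_zero]
    have h'' : a + b + (a + b) = 0 := by rw [← add_assoc, h, hb]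
    rintro x y (rfl | rfl | rfl | rfl) (rfl | rfl | rfl | rfl) <;>
      simp [ha, hb, hab, hba, h, h', h'', hcomm]
  neg_mem' := by
    rw [two_nsmul] at ha hb
    have ha' : -a = a := neg_eq_of_add_eq_zero_left ha
    have hb' : -b = b := neg_eq_of_add_eq_zero_left hb
    rintro x (rfl | rfl | rfl | rfl) <;> simp [ha', hb', add_comm]

theorem mem_kleinFour {G : Type*} [AddCommGroup G] {a b : G} (ha : 2 • a = 0) (hb : 2 • b = 0)
    {x : G} : x ∈ kleinFour ha hb ↔ x = 0 ∨ x = a ∨ x = b ∨ x = a + b := Iff.rfl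

theorem two_nsmul_of_mem_kleinFour {G : Type*} [AddCommGroup G] {a b : G} (ha : 2 • a = 0)
    (hb : 2 • b = 0) {x : G} (hx : x ∈ kleinFour ha hb) : 2 • x = 0 := by
  rcases hx with rfl | rfl | rfl | rfl
  · simp
  · exact ha
  · exact hb
  · rw [smul_add, ha, hb, add_zero]

theorem IsInvolution.add_ne_zero {G : Type*} [AddCommGroup G] {a b : G} (ha : IsInvolution a)
    (hab : a ≠ b) : a + b ≠ 0 := by
  intro h
  have := ha.2
  rw [two_nsmul] at this
  exact hab (add_left_cancel (this.trans h.symm))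

theorem card_kleinFour {G : Type*} [AddCommGroup G] {a b : G} (ha : IsInvolution a)
    (hb : IsInvolution b) (hab : a ≠ b) : Nat.card (kleinFour ha.2 hb.2) = 4 := by
  classical
  have : ((kleinFour ha.2 hb.2 : AddSubgroup G) : Set G) =
      (({0, a, b, a + b} : Finset G) : Set G) := by
    simp only [coe_insert, coe_singleton]
    rfl
  rw [← SetLike.coe_sort_coe, this, Nat.card_eq_card_toFinset, Finset.toFinset_coe,
    card_insert_of_notMem, card_insert_of_notMem, card_insert_of_notMem, card_singleton]
  · simp [ha.1]
  · simp [hab, hb.1]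
  · simp [ha.1.symm, hb.1.symm, (ha.add_ne_zero hab).symm]

/-- The position of an index: first, last, or in between. -/
def endClass {m : ℕ} (i : Fin m) : Fin 3 :=
  if i.val = 0 then 0 else if i.val + 1 = m then 2 else 1

theorem endClass_rev {m : ℕ} (hm : m ≠ 1) (i : Fin m) :
    endClass (Fin.rev i) = Fin.rev (endClass i) := by
  have hi := i.2
  simp only [endClass, Fin.val_rev]
  split_ifs <;> first | rfl | omega

/-- An odd number m - 2 of middle indices contributes just one copy of `F 1`. This stretches a 3 × 3
pattern to any odd side. -/
theorem sum_endClass {G : Type*} [AddCommGroup G] {m : ℕ} (hm : Odd m) (hm1 : m ≠ 1)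
    (F : Fin 3 → G) (hF : 2 • F 1 = 0) :
    ∑ i : Fin m, F (endClass i) = F 0 + F 1 + F 2 := by
  obtain ⟨k, rfl⟩ := hm
  obtain ⟨k, rfl⟩ := Nat.exists_eq_succ_of_ne_zero (n := k) (by rintro rfl; simp at hm1)
  have h : ∀ i : Fin (2 * k + 1), endClass (m := 2 * k + 1 + 1 + 1) i.castSucc.succ = 1 := by
    intro i
    have := i.2
    simp only [endClass, Fin.val_succ, Fin.val_castSucc]
    rw [if_neg (by omega), if_neg (by omega)]
  have h0 : endClass (m := 2 * k + 1 + 1 + 1) 0 = 0 := rfl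
  have h2 : endClass (m := 2 * k + 1 + 1 + 1) (Fin.last (2 * k + 1)).succ = 2 := by
    simp [endClass]
  change ∑ i : Fin (2 * k + 1 + 1 + 1), F (endClass i) = _
  rw [Fin.sum_univ_succ, Fin.sum_univ_castSucc]
  simp only [h, h0, h2, sum_const, card_univ, Fintype.card_fin]
  rw [add_nsmul, mul_comm, mul_nsmul', hF, smul_zero, zero_add, one_nsmul, add_assoc]

theorem exists_zeroSumMagicSquare_of_kleinFour {Γ : Type*} [AddCommGroup Γ] {m : ℕ}
    (hm : m ≠ 0) (hm1 : m ≠ 1) (hcard : Nat.card Γ = (m * 2) ^ 2) {a b : Γ}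
    (ha : IsInvolution a) (hb : IsInvolution b) (hab : a ≠ b)
    {B : Fin m → Fin m → Γ ⧸ kleinFour ha.2 hb.2} (hB : IsZeroSumMagicSquare B) :
    ∃ A : Fin (m * 2) → Fin (m * 2) → Γ, IsZeroSumMagicSquare A := by
  have hV2 : ∀ v ∈ kleinFour ha.2 hb.2, 2 • v = 0 := fun v =>
    two_nsmul_of_mem_kleinFour ha.2 hb.2
  have hc := ha.add_ne_zero hab
  have hab2 : 2 • (a + b) = 0 := by rw [smul_add, ha.2, hb.2, add_zero]
  rcases Nat.even_or_odd m with he | ho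
  · have hz : ∀ x : Γ, 2 • x = 0 → m • x = 0 := by
      intro x hx
      obtain ⟨k, rfl⟩ := he.two_dvd
      rw [mul_nsmul, hx, smul_zero]
    refine exists_zeroSumMagicSquare_of_quotient hm hcard _ hV2 hB (fun _ _ => a) (fun _ _ => b)
      (fun _ _ => ?_) (fun _ _ => ?_) (fun _ _ => ha.1) (fun _ _ => hb.1) (fun _ _ => hab)
      ?_ ?_ ?_ ?_
    · simp [mem_kleinFour]
    · simp [mem_kleinFour]
    all_goals simp [hz _ ha.2, hz _ hb.2, hz _ hab2]
  · let val : Fin 3 → Γ := ![a, b, a + b]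
    have hval : ∀ t, val t ∈ kleinFour ha.2 hb.2 := by
      intro t
      rw [mem_kleinFour]
      fin_cases t <;> simp [val]
    have hval0 : ∀ t, val t ≠ 0 := by
      intro t
      fin_cases t <;> simp [val, ha.1, hb.1, hc]
    have hinj : Function.Injective val := by
      intro t t'
      fin_cases t <;> fin_cases t' <;>
        simp [val, hab, hab.symm, ha.1, hb.1]
    -- The tables differ in every cell; rows of S and columns of C are permutations, and on each
    -- diagonal S and C together use every value twice.
    let S : Fin 3 → Fin 3 → Fin 3 := ![![0, 1, 2], ![0, 1, 2], ![1, 2, 0]]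
    let C : Fin 3 → Fin 3 → Fin 3 := ![![1, 0, 0], ![2, 2, 1], ![0, 1, 2]]
    have hSC : ∀ i j, S i j ≠ C i j := by decide
    have hval2 : ∀ t, 2 • val t = 0 := fun t => hV2 _ (hval t)
    have h3 : a + b + (a + b) = 0 := by rw [← two_nsmul, hab2]
    have hSrow : ∀ i, val (S i 0) + val (S i 1) + val (S i 2) = 0 := by
      intro i
      fin_cases i <;> simp [S, val]
      · exact h3
      · exact h3
      · rw [← h3]; abel
    have hCcol : ∀ j, val (C 0 j) + val (C 1 j) + val (C 2 j) = 0 := by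
      intro i
      fin_cases i <;> simp [C, val] <;> rw [← h3] <;> abel
    refine exists_zeroSumMagicSquare_of_quotient hm hcard _ hV2 hB
      (fun i j => val (S (endClass i) (endClass j))) (fun i j => val (C (endClass i) (endClass j)))
      (fun _ _ => hval _) (fun _ _ => hval _) (fun _ _ => hval0 _) (fun _ _ => hval0 _)
      (fun _ _ => hinj.ne (hSC _ _)) (fun i => ?_) (fun j => ?_) ?_ ?_
    · rw [sum_endClass ho hm1 (fun j => val (S (endClass i) j)) (hval2 _), hSrow]
    · rw [sum_endClass ho hm1 (fun i => val (C i (endClass j))) (hval2 _), hCcol]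
    · rw [sum_endClass ho hm1 (fun i => val (S i i) + val (C i i))
        (by rw [smul_add, hval2, hval2, add_zero])]
      calc _ = 2 • (a + b) + 2 • (a + b) := by simp [S, C, val]; abel
        _ = 0 := by rw [hab2, add_zero]
    · simp only [endClass_rev hm1]
      rw [sum_endClass ho hm1 (fun i => val (S i i.rev) + val (C i i.rev))
        (by rw [smul_add, hval2, hval2, add_zero])]
      calc _ = 2 • (a + b) + 2 • (a + b) := by simp [S, C, val, Fin.rev]; abel
        _ = 0 := by rw [hab2, add_zero]

/-! ### Doubly even side -/

theorem Equiv.Perm.cycleType_of_involutive {α : Type*} [Fintype α] [DecidableEq α]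
    (τ : Equiv.Perm α) (h : ∀ x, τ (τ x) = x) (hfix : ∀ x, τ x ≠ x) :
    τ.cycleType = Multiset.replicate (Fintype.card α / 2) 2 := by
  have hτ : τ ^ 2 = 1 := by
    ext x
    simp [sq, h]
  have hall : ∀ k ∈ τ.cycleType, k = 2 := fun k hk =>
    le_antisymm (Nat.le_of_dvd two_pos ((Equiv.Perm.dvd_of_mem_cycleType hk).trans
      (orderOf_dvd_of_pow_eq_one hτ))) (Equiv.Perm.two_le_of_mem_cycleType hk)
  have hrep := Multiset.eq_replicate_card.2 hall
  have hsum := τ.sum_cycleType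
  have hsupp : τ.support = univ := by
    ext x
    simp [hfix]
  rw [hsupp, card_univ, hrep, Multiset.sum_replicate, smul_eq_mul] at hsum
  rw [hrep, ← hsum]
  simp

/-- A fixed-point-free involution on a set with `n` elements, `n` even, is the reversal in a
suitable enumeration. -/
theorem exists_equiv_rev {X : Type*} [Finite X] {n : ℕ} (hn : Even n) (hX : Nat.card X = n)
    (σ : X → X) (h : ∀ x, σ (σ x) = x) (hfix : ∀ x, σ x ≠ x) :
    ∃ f : Fin n ≃ X, ∀ i, f (Fin.rev i) = σ (f i) := by
  let g : Fin n ≃ X := (Finite.equivFinOfCardEq hX).symm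
  let τ : Equiv.Perm (Fin n) := (g.trans (⟨σ, σ, h, h⟩ : Equiv.Perm X)).trans g.symm
  have h1 := τ.cycleType_of_involutive (fun i => by simp [τ, h]) (fun i hi => by
    apply hfix (g i)
    simpa [τ, Equiv.symm_apply_eq] using hi)
  have h2 := (Fin.revPerm (n := n)).cycleType_of_involutive (fun i => by simp) (fun i hi => by
    have := congrArg Fin.val hi
    simp only [Fin.revPerm_apply, Fin.val_rev] at this
    have := i.2
    obtain ⟨k, hk⟩ := hn
    omega)
  obtain ⟨π, hπ⟩ := isConj_iff.1 (Equiv.Perm.isConj_of_cycleType_eq (h2.trans h1.symm))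
  refine ⟨π.trans g, fun i => ?_⟩
  have := congrArg (fun ρ : Equiv.Perm (Fin n) => g (ρ (π i))) hπ
  simpa [τ] using this

/-- G / 2G is a vector space over `ZMod 2` in which e is nonzero, so a linear functional detects e.
-/
theorem exists_hom_zmod_two {G : Type*} [AddCommGroup G] {e : G} (he : ∀ x, 2 • x ≠ e) :
    ∃ χ : G →+ ZMod 2, χ e = 1 := by
  let D : AddSubgroup G := (nsmulAddMonoidHom 2).range
  have h2 : ∀ q : G ⧸ D, 2 • q = 0 := by
    intro q
    obtain ⟨x, rfl⟩ := QuotientAddGroup.mk_surjective q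
    rw [← QuotientAddGroup.mk_nsmul, QuotientAddGroup.eq_zero_iff]
    exact ⟨x, rfl⟩
  let _ : Module (ZMod 2) (G ⧸ D) := AddCommGroup.zmodModule h2
  have he0 : (e : G ⧸ D) ≠ 0 := by
    rw [Ne, QuotientAddGroup.eq_zero_iff]
    rintro ⟨x, hx⟩
    exact he x hx
  have := mt (Module.forall_dual_apply_eq_zero_iff (ZMod 2) (e : G ⧸ D)).1 he0
  push Not at this
  obtain ⟨φ, hφ⟩ := this
  refine ⟨φ.toAddMonoidHom.comp (QuotientAddGroup.mk' D), ?_⟩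
  change φ (e : G ⧸ D) = 1
  generalize φ (e : G ⧸ D) = z at hφ
  fin_cases z
  · exact absurd rfl hφ
  · rfl

theorem exists_addSubgroup_le_ker {G : Type*} [AddCommGroup G] [Finite G] {n : ℕ}
    (χ : G →+ ZMod 2) {e : G} (he : χ e = 1) (hn : n * 2 ∣ Nat.card G) :
    ∃ H : AddSubgroup G, Nat.card H = n ∧ ∀ h ∈ H, χ h = 0 := by
  have hrange : χ.range = ⊤ := by
    rw [AddMonoidHom.range_eq_top]
    intro z
    fin_cases z
    · exact ⟨0, map_zero χ⟩
    · exact ⟨e, he⟩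
  have hcard := χ.ker.card_mul_index
  rw [AddSubgroup.index_ker, hrange, AddSubgroup.card_top, Nat.card_zmod] at hcard
  obtain ⟨H, hH⟩ := AddSubgroup.exists_card_eq_of_dvd n (G := χ.ker)
    (Nat.dvd_of_mul_dvd_mul_right two_pos (hcard ▸ hn))
  refine ⟨H.map χ.ker.subtype, ?_, ?_⟩
  · rw [← hH]
    exact Nat.card_congr (H.equivMapOfInjective _ χ.ker.subtype_injective).symm.toEquiv
  · rintro _ ⟨⟨x, hx⟩, -, rfl⟩
    exact hx

theorem exists_ne_two_nsmul {G : Type*} [AddCommGroup G] [Finite G] (h : 2 ∣ Nat.card G) :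
    ∃ c : G, ∀ x, 2 • x ≠ c := by
  by_contra! hsurj
  have hinj := (Finite.injective_iff_surjective (f := fun x : G => 2 • x)).2 hsurj
  obtain ⟨ι, hι⟩ := exists_prime_addOrderOf_dvd_card' (G := G) 2 h
  have : ι = 0 := hinj (by
    change 2 • ι = 2 • 0
    rw [smul_zero, ← hι, addOrderOf_nsmul_eq_zero])
  rw [this] at hι
  simp at hι

/-- The index pattern of doubly even squares. -/
def isInner {k : ℕ} (i : Fin (k * 4)) : Bool := i.val % 4 = 1 ∨ i.val % 4 = 2

theorem isInner_rev {k : ℕ} (i : Fin (k * 4)) : isInner (Fin.rev i) = isInner i := by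
  have := i.2
  simp only [isInner, Fin.val_rev, decide_eq_decide]
  omega

/-- Reversal preserves innerness and pairs indices so that each pair contributes c; the inner and
outer indices form k pairs each. -/
theorem sum_ite_isInner {G : Type*} [AddCommGroup G] {k : ℕ} {c : G} (z : Fin (k * 4) → G)
    (hz : ∀ i, z (Fin.rev i) = c - z i) :
    (∑ i, if isInner i then z i else - z i) = 0 ∧ ∑ i, z i = (2 * k) • c := by
  let φ : Fin k × Fin 4 ≃ Fin (k * 4) := finProdFinEquiv
  have hrev : ∀ i u, Fin.rev (φ (i, u)) = φ (Fin.rev i, Fin.rev u) := by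
    intro i u
    ext
    simp only [φ, finProdFinEquiv_apply_val, Fin.val_rev]
    omega
  have hinner : ∀ i u, isInner (φ (i, u)) = decide (u = 1 ∨ u = 2) := by
    intro i u
    have := u.2
    simp only [isInner, φ, finProdFinEquiv_apply_val, decide_eq_decide, Fin.ext_iff]
    change _ ↔ (u.val = 1 ∨ u.val = 2)
    omega
  have hY : ∀ u, ∑ i, z (φ (i, Fin.rev u)) = k • c - ∑ i, z (φ (i, u)) := by
    intro u
    rw [← Equiv.sum_comp Fin.revPerm]
    simp [← hrev, hz, Finset.sum_sub_distrib]
  have h3 : ∑ i, z (φ (i, 3)) = k • c - ∑ i, z (φ (i, 0)) := hY 0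
  have h2 : ∑ i, z (φ (i, 2)) = k • c - ∑ i, z (φ (i, 1)) := hY 1
  constructor
  · rw [← φ.sum_comp, Fintype.sum_prod_type]
    simp only [hinner, Fin.sum_univ_four, sum_add_distrib]
    simp [h2, h3]
  · rw [← φ.sum_comp, Fintype.sum_prod_type]
    simp only [Fin.sum_univ_four, sum_add_distrib]
    rw [h2, h3, two_mul, add_nsmul]
    abel

theorem sum_ite_isInner_const {G : Type*} [AddCommGroup G] {k : ℕ} (p q : G) :
    (∑ i : Fin (k * 4), if isInner i then p else q) = (2 * k) • (p + q) := by
  rw [← finProdFinEquiv.sum_comp, Fintype.sum_prod_type]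
  have h : ∀ i : Fin k, (∑ u : Fin 4, if isInner (finProdFinEquiv (i, u)) then p else q) =
      2 • (p + q) := by
    intro i
    simp only [isInner, finProdFinEquiv_apply_val, Fin.sum_univ_four, Nat.add_mul_mod_self_left]
    simp [two_nsmul]
    abel
  simp only [h, sum_const, card_univ, Fintype.card_fin, mul_nsmul, smul_add]

theorem exists_zeroSumMagicSquare_of_four_dvd {Γ : Type*} [AddCommGroup Γ] {k : ℕ} (hk : k ≠ 0)
    (hcard : Nat.card Γ = (k * 4) ^ 2) {e : Γ} (he : ∀ x, 2 • x ≠ e) (hke : (2 * k) • e = 0) :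
    ∃ A : Fin (k * 4) → Fin (k * 4) → Γ, IsZeroSumMagicSquare A := by
  have hfin : Finite Γ := Nat.finite_of_card_ne_zero (by rw [hcard]; positivity)
  have heven : Even (k * 4) := ⟨k * 2, by ring⟩
  obtain ⟨χ, hχ⟩ := exists_hom_zmod_two he
  obtain ⟨H, hH, hHχ⟩ := exists_addSubgroup_le_ker (n := k * 4) χ hχ
    ⟨2 * k, by rw [hcard]; ring⟩
  have hQ : Nat.card (Γ ⧸ H) = k * 4 := by
    have := AddSubgroup.card_eq_card_quotient_mul_card_addSubgroup H
    rw [hH, hcard, sq] at this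
    exact (Nat.eq_of_mul_eq_mul_right (by omega) this).symm
  obtain ⟨c, hc⟩ := exists_ne_two_nsmul (G := H) ⟨k * 2, by rw [hH]; ring⟩
  obtain ⟨y, hy⟩ := exists_equiv_rev heven hH (fun h => c - h) (fun h => by simp) (fun h hh =>
    hc h (by rw [two_nsmul]; nth_rewrite 1 [← hh]; simp))
  have hχ2 : ∀ x, χ (2 • x) = 0 := by
    intro x
    rw [map_nsmul]
    generalize χ x = z
    revert z
    decide
  -- A fixed coset would put e - c - 2x in H, where χ vanishes; but χ takes the value 1 there.
  obtain ⟨f, hf⟩ := exists_equiv_rev heven hQ (fun q => ((e - c : Γ) : Γ ⧸ H) - q)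
    (fun q => by simp) (fun q hq => by
      obtain ⟨x, rfl⟩ := QuotientAddGroup.mk_surjective q
      have h0 : ((e - c - 2 • x : Γ) : Γ ⧸ H) = 0 := by
        rw [two_nsmul, ← sub_sub, QuotientAddGroup.mk_sub, QuotientAddGroup.mk_sub, hq, sub_self]
      have := hHχ _ ((QuotientAddGroup.eq_zero_iff _).1 h0)
      rw [map_sub, map_sub, hχ, hχ2, hHχ _ c.2] at this
      simp at this)
  -- Representatives are free on the first half and reflected on the second, so the symmetry holds
  -- in `Γ` and not merely modulo H.
  obtain ⟨x, hx, hxf⟩ : ∃ x : Fin (k * 4) → Γ, (∀ i, x (Fin.rev i) = (e - c) - x i) ∧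
      ∀ i, (x i : Γ ⧸ H) = f i := by
    refine ⟨fun i => if i < Fin.rev i then (f i).out else (e - c) - (f (Fin.rev i)).out,
      fun i => ?_, fun i => ?_⟩
    · have hne : i ≠ Fin.rev i := by
        intro h
        have := congrArg Fin.val h
        rw [Fin.val_rev] at this
        omega
      simp only [Fin.rev_rev]
      rcases lt_or_gt_of_ne hne with h | h
      · rw [if_neg h.not_gt, if_pos h]
      · rw [if_pos h, if_neg h.not_gt, sub_sub_cancel]
    · dsimp only
      split_ifs
      · exact QuotientAddGroup.out_eq' _
      · rw [QuotientAddGroup.mk_sub, QuotientAddGroup.out_eq', hf, sub_sub_cancel]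
  have hy' : ∀ i, (y (Fin.rev i) : Γ) = c - y i := fun i => by rw [hy]; rfl
  have hinj : ∀ i j i' j', x i + y j = x i' + y j' → i = i' ∧ j = j' := by
    intro i j i' j' h
    have hi : i = i' := by
      have := congrArg (QuotientAddGroup.mk (s := H)) h
      rw [QuotientAddGroup.mk_add_of_mem _ (SetLike.coe_mem _),
        QuotientAddGroup.mk_add_of_mem _ (SetLike.coe_mem _), hxf, hxf] at this
      exact f.injective this
    subst hi
    exact ⟨rfl, y.injective (Subtype.ext (add_left_cancel h))⟩
  -- Central reflection replaces an entry by its complement to e. Rows and columns meet it in half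
  -- of their cells, the diagonals in none, so each line sums to 2k • e = 0.
  let A : Fin (k * 4) → Fin (k * 4) → Γ := fun i j =>
    if isInner i = isInner j then x i + y j else x (Fin.rev i) + y (Fin.rev j)
  have hrev : ∀ i j, x (Fin.rev i) + y (Fin.rev j) = e - (x i + y j) := by
    intro i j
    rw [hx, hy']
    abel
  have hline : ∀ (b : Bool) (w : Γ) (z : Fin (k * 4) → Γ) (d : Γ),
      (∀ i, z (Fin.rev i) = d - z i) →
      (∑ j, if b = isInner j then w + z j else e - (w + z j)) = 0 := by
    intro b w z d hz
    have h1 := (sum_ite_isInner z hz).1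
    cases b
    · have h2 := sum_ite_isInner_const (k := k) (e - w) w
      rw [sub_add_cancel, hke] at h2
      refine Eq.trans ?_ ((congrArg₂ (· - ·) h2 h1).trans (sub_zero 0))
      simp only [← sum_sub_distrib]
      refine sum_congr rfl fun j _ => ?_
      cases isInner j <;> simp [sub_sub]
    · have h2 := sum_ite_isInner_const (k := k) w (e - w)
      rw [add_sub_cancel, hke] at h2
      refine Eq.trans ?_ ((congrArg₂ (· + ·) h2 h1).trans (add_zero 0))
      simp only [← sum_add_distrib]
      refine sum_congr rfl fun j _ => ?_
      cases isInner j <;> simp [sub_sub, ← sub_eq_add_neg]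
  refine ⟨A, existsUnique_entry_of_injective A (by omega) hcard ?_, ?_, ?_, ?_, ?_⟩
  · rintro ⟨i, j⟩ ⟨i', j'⟩ h
    simp only [A] at h
    split_ifs at h with h1 h2 h2
    · obtain ⟨rfl, rfl⟩ := hinj _ _ _ _ h
      rfl
    · obtain ⟨rfl, rfl⟩ := hinj _ _ _ _ h
      simp only [isInner_rev] at h1
      exact absurd h1 h2
    · obtain ⟨rfl, rfl⟩ := hinj _ _ _ _ h
      simp only [isInner_rev] at h2
      exact absurd h2 h1
    · obtain ⟨h3, h4⟩ := hinj _ _ _ _ h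
      rw [Fin.rev_injective h3, Fin.rev_injective h4]
  · intro i
    simp only [A, hrev]
    exact hline _ _ _ _ hy'
  · intro j
    simp only [A, hrev, eq_comm (b := isInner j), add_comm _ (y j : Γ)]
    exact hline _ _ _ _ hx
  · simp only [A, if_true]
    rw [(sum_ite_isInner (c := e) (fun i => x i + y i) fun i => hrev i i).2, hke]
  · simp only [A, isInner_rev, if_true]
    rw [(sum_ite_isInner (c := e) (fun i => x i + y (Fin.rev i)) fun i => hrev i _).2, hke]

/-! ### The exceptional group of order 16 and the induction -/

theorem addHom_zmod_four_injective {G : Type*} [AddCommGroup G] {a b : G}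
    (ha : 4 • a = 0) (hb : 4 • b = 0) (ha2 : 2 • a ≠ 0) (hb2 : 2 • b ≠ 0)
    (hab : 2 • a + 2 • b ≠ 0) :
    ∃ φ : ZMod 4 × ZMod 4 →+ G, Function.Injective φ := by
  let α : ZMod 4 →+ G := ZMod.lift 4 ⟨zmultiplesHom G a, (natCast_zsmul a 4).trans ha⟩
  let β : ZMod 4 →+ G := ZMod.lift 4 ⟨zmultiplesHom G b, (natCast_zsmul b 4).trans hb⟩
  have hα2 : α 2 = 2 • a := by
    exact (ZMod.lift_coe 4 ⟨zmultiplesHom G a, (natCast_zsmul a 4).trans ha⟩ 2).trans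
      (natCast_zsmul a 2)
  have hβ2 : β 2 = 2 • b := by
    exact (ZMod.lift_coe 4 ⟨zmultiplesHom G b, (natCast_zsmul b 4).trans hb⟩ 2).trans
      (natCast_zsmul b 2)
  refine ⟨α.coprod β, (injective_iff_map_eq_zero _).2 ?_⟩
  -- A nonzero kernel element or its double would be one of the three involutions, whose images are
  -- nonzero.
  have key : ∀ p : ZMod 4 × ZMod 4, p ≠ 0 →
      p = (2, 0) ∨ p = (0, 2) ∨ p = (2, 2) ∨
        p + p = (2, 0) ∨ p + p = (0, 2) ∨ p + p = (2, 2) := by decide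
  intro p hp
  by_contra hne
  have hpp : α.coprod β (p + p) = 0 := by rw [map_add, hp, add_zero]
  rcases key p hne with h | h | h | h | h | h
  on_goal 1 => rw [h] at hp
  on_goal 2 => rw [h] at hp
  on_goal 3 => rw [h] at hp
  on_goal 4 => rw [h] at hpp
  on_goal 5 => rw [h] at hpp
  on_goal 6 => rw [h] at hpp
  all_goals simp_all

theorem exists_zeroSumMagicSquare_of_zmod_four {Γ : Type*} [AddCommGroup Γ]
    (φ : ZMod 4 × ZMod 4 →+ Γ) (hφ : Function.Injective φ) (hcard : Nat.card Γ = 4 ^ 2) :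
    ∃ A : Fin 4 → Fin 4 → Γ, IsZeroSumMagicSquare A := by
  let M : Fin 4 → Fin 4 → ZMod 4 × ZMod 4 :=
    ![![(1, 0), (2, 1), (3, 1), (2, 2)], ![(0, 0), (1, 3), (0, 1), (3, 0)],
      ![(1, 1), (0, 2), (3, 2), (0, 3)], ![(2, 3), (1, 2), (2, 0), (3, 3)]]
  have hM : Function.Injective (fun p : Fin 4 × Fin 4 => M p.1 p.2) := by decide
  have hrow : ∀ i, ∑ j, M i j = 0 := by decide
  have hcol : ∀ j, ∑ i, M i j = 0 := by decide
  have hdiag : ∑ i, M i i = 0 := by decide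
  have hanti : ∑ i, M i (Fin.rev i) = 0 := by decide
  refine ⟨fun i j => φ (M i j),
    existsUnique_entry_of_injective (fun i j => φ (M i j)) (by norm_num) hcard
      (hφ.comp hM), ?_, ?_, ?_, ?_⟩
  · exact fun i => by rw [← map_sum, hrow, map_zero]
  · exact fun j => by rw [← map_sum, hcol, map_zero]
  · rw [← map_sum, hdiag, map_zero]
  · rw [← map_sum, hanti, map_zero]

theorem isInvolution_mk {G : Type*} [AddCommGroup G] {V : AddSubgroup G}
    (hV2 : ∀ v ∈ V, 2 • v = 0) {x : G} (hx : 2 • x ∈ V) (hx0 : 2 • x ≠ 0) :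
    IsInvolution (x : G ⧸ V) := by
  refine ⟨fun h => hx0 (hV2 _ ((QuotientAddGroup.eq_zero_iff _).1 h)), ?_⟩
  rw [← QuotientAddGroup.mk_nsmul]
  exact (QuotientAddGroup.eq_zero_iff _).2 hx

theorem exists_zeroSumMagicSquare {n : ℕ} (hn : 2 < n) :
    ∀ {Γ : Type*} [AddCommGroup Γ], Nat.card Γ = n ^ 2 → InClassG Γ →
      ∃ A : Fin n → Fin n → Γ, IsZeroSumMagicSquare A := by
  induction n using Nat.strong_induction_on with
  | _ n ih =>
    intro Γ _ hcard hG
    rcases Nat.even_or_odd n with he | ho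
    swap
    · exact exists_zeroSumMagicSquare_of_odd ho hcard
    rcases hG with hodd | ⟨a, b, hab, ha, hb⟩
    · rw [hcard, ← Nat.not_even_iff_odd] at hodd
      exact absurd (he.pow_of_ne_zero two_ne_zero) hodd
    obtain ⟨m, rfl⟩ : ∃ m, n = m * 2 := ⟨n / 2, by have := he.two_dvd; omega⟩
    have hfin : Finite Γ := Nat.finite_of_card_ne_zero (by rw [hcard]; positivity)
    have hV := card_kleinFour ha hb hab
    have hV2 : ∀ v ∈ kleinFour ha.2 hb.2, 2 • v = 0 := fun v =>
      two_nsmul_of_mem_kleinFour ha.2 hb.2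
    have hQ : Nat.card (Γ ⧸ kleinFour ha.2 hb.2) = m ^ 2 := by
      have := AddSubgroup.card_eq_card_quotient_mul_card_addSubgroup (kleinFour ha.2 hb.2)
      rw [hV, hcard, mul_pow] at this
      omega
    have inflate : (∃ B : Fin m → Fin m → Γ ⧸ kleinFour ha.2 hb.2, IsZeroSumMagicSquare B) →
        ∃ A : Fin (m * 2) → Fin (m * 2) → Γ, IsZeroSumMagicSquare A := fun ⟨_, hB⟩ =>
      exists_zeroSumMagicSquare_of_kleinFour (by omega) (by omega) hcard ha hb hab hB
    rcases Nat.even_or_odd m with hme | hmo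
    swap
    · exact inflate (exists_zeroSumMagicSquare_of_odd hmo hQ)
    obtain ⟨k, rfl⟩ := hme.two_dvd
    by_cases hex : ∃ e : Γ, (∀ x, 2 • x ≠ e) ∧ (2 * k) • e = 0
    · obtain ⟨e, he, hke⟩ := hex
      rw [show 2 * k * 2 = k * 4 by ring] at *
      exact exists_zeroSumMagicSquare_of_four_dvd (by omega) hcard he hke
    push Not at hex
    have half : ∀ v : Γ, 2 • v = 0 → ∃ x, 2 • x = v := by
      intro v hv
      by_contra! h
      exact hex v h (by rw [mul_nsmul, hv, smul_zero])
    obtain ⟨x, hx⟩ := half a ha.2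
    obtain ⟨y, hy⟩ := half b hb.2
    -- For k = 1 the quotient would need a square of side 2, so `Γ` is treated directly through x
    -- and y of order 4.
    rcases eq_or_ne k 1 with rfl | hk
    · obtain ⟨φ, hφ⟩ := addHom_zmod_four_injective (a := x) (b := y)
        (by rw [show 4 = 2 * 2 from rfl, mul_nsmul, hx, ha.2])
        (by rw [show 4 = 2 * 2 from rfl, mul_nsmul, hy, hb.2])
        (by rw [hx]; exact ha.1) (by rw [hy]; exact hb.1)
        (by rw [hx, hy]; exact ha.add_ne_zero hab)
      exact exists_zeroSumMagicSquare_of_zmod_four φ hφ hcard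
    refine inflate (ih (2 * k) (by omega) (by omega) hQ (Or.inr ⟨x, y, fun h => ?_,
      isInvolution_mk hV2 ?_ ?_, isInvolution_mk hV2 ?_ ?_⟩))
    · have hxy := hV2 _ ((QuotientAddGroup.eq (s := kleinFour ha.2 hb.2)).1 h)
      rw [smul_add, smul_neg, hx, hy, neg_add_eq_zero] at hxy
      exact hab hxy
    · rw [hx, mem_kleinFour]; simp
    · rw [hx]; exact ha.1
    · rw [hy, mem_kleinFour]; simp
    · rw [hy]; exact hb.1

theorem theorem3 {Γ : Type*} [AddCommGroup Γ] (n : ℕ)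
    (hcard : Nat.card Γ = n ^ 2) (hn : 1 < n ^ 2) :
    ExistsNontrivialZMS Γ n ↔ 2 < n ∧ InClassG Γ := by
  have hfin : Finite Γ := Nat.finite_of_card_ne_zero (by omega)
  constructor
  · rintro ⟨hn1, A, hA⟩
    refine ⟨?_, hA.inClassG⟩
    by_contra! hle
    interval_cases n
    · simp at hn
    · exact hn1 rfl
    · exact hA.side_ne_two
  · rintro ⟨h2, hG⟩
    exact ⟨by omega, exists_zeroSumMagicSquare h2 hcard hG⟩
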